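/- Let $a\in C^1([0,\pi]\times\mathbb R^2)$ and $f\in C^2([0,\pi]\times\mathbb R^2)$ be real functions of $(x,u,p)$ with $a\ge\epsilon$ for some constant $\epsilon>0$, and consider $$u_t=a(x,u,u_x)u_{xx}+f(x,u,u_x),\qquad x\in[0,\pi],\quad u_x=0\text{ at }x=0,\pi.$$ An equilibrium is a $u_*\in C^2([0,\pi])$ with $a(x,u_*,u_*')u_*''+f(x,u_*,u_*')=0$ on $[0,\pi]$ and $u_*'(0)=u_*'(\pi)=0$. The eigenvalues of its linearization are the $\lambda\in\mathbb C$ for which $$a_*\varphi''+b_*\varphi+c_*\varphi'=\lambda\varphi,\quad \varphi'(0)=\varphi'(\pi)=0,$$ has a solution $\varphi\in C^2([0,\pi];\mathbb C)$, $\varphi\not\equiv0$, where $a_*=a$, $b_*=a_u u_*''+f_u$, $c_*=a_p u_*''+f_p$, all evaluated at $(x,u_*(x),u_*'(x))$. The equilibrium is hyperbolic if no eigenvalue is purely imaginary or zero; its Morse index $i(u_*)$ is the number of positive eigenvalues. Suppose that for every $b\in\mathbb R$ the solution $(u(x,b),p(x,b))$ of $$u_x=p,\qquad p_x=-\frac{f(x,u,p)}{a(x,u,p)},\qquad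 (u,p)(0)=(b,0),$$ exists for all $x\in[0,\pi]$. For $x\in[0,\pi]$ let $M_x=\{(x,u(x,b),p(x,b)):b\in\mathbb R\}$, and let $L_\pi=\{(\pi,u,0):u\in\mathbb R\}$. Then: 1. The map $u_*\mapsto(\pi,u_*(\pi),u_*'(\pi))$ is a bijection from the set of equilibria onto $M_\pi\cap L_\pi$; moreover each equilibrium $u_*$ is the trajectory with $b=u_*(0)$, that is, $(u_*(x),u_*'(x))=(u(x,b),p(x,b))$ on $[0,\pi]$. 2. An equilibrium $u_*$ is hyperbolic if and only if $M_\pi$ and $L_\pi$ intersect transversely at the point with parameter $b=u_*(0)$, that is, the tangent vector $(\partial_bu,\partial_bp)(\pi,b)$ exists and together with $(1,0)$ spans $\mathbb R^2$. 3. Let $u_*$ be an equilibrium and $b=u_*(0)$. There is a unique number $\zeta$, the clockwise angle from $L_\pi$ to $M_\pi$ at the intersection point, such that the tangent vectors to the curves $M_x$ along $u_*$ exist and are of the form $(\partial_bu,\partial_bp)(x,b)=\rho(x)(\cos\nu(x),-\sin\nu(x))$ for all $x\in[0,\pi]$, with $\rho>0$, $\nu$ continuous on $[0,\pi]$, $\nu(0)=0$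 and $\nu(\pi)=\zeta$. If $u_*$ is hyperbolic, then its Morse index is finite and $i(u_*)=1+\lfloor\zeta/\pi\rfloor$. -/

import Mathlib

noncomputable section

namespace SturmShooting

/-- The spatial interval `[0, π]`. -/
abbrev I : Set ℝ := Set.Icc 0 Real.pi

/-- The left end point of the interval. -/
def leftEnd : I := ⟨0, le_rfl, Real.pi_pos.le⟩

/-- The right end point of the interval. -/
def rightEnd : I := ⟨Real.pi, Real.pi_pos.le, le_rfl⟩

/-- A function on `[0, π]`, read as a function on `ℝ`. Only its values on `[0, π]` are ever used:
all derivatives below are derivatives within `[0, π]` (one-sided at the end points). -/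
def onLine (u : I → ℝ) : ℝ → ℝ := Set.IccExtend Real.pi_pos.le u

/-- First derivative on `[0, π]`. -/
def D {F : Type*} [NormedAddCommGroup F] [NormedSpace ℝ F] (g : ℝ → F) : ℝ → F :=
  fun x => derivWithin g I x

/-- A coefficient `(x, u, p) ↦ h x u p` is of class `C^n` on `[0, π] × ℝ × ℝ`. -/
def IsCoeff (n : ℕ) (h : ℝ → ℝ → ℝ → ℝ) : Prop :=
  ContDiffOn ℝ n (fun q : ℝ × ℝ × ℝ => h q.1 q.2.1 q.2.2) (I ×ˢ Set.univ)

/-- Partial derivative with respect to `u`. -/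
def partialU (h : ℝ → ℝ → ℝ → ℝ) (x u p : ℝ) : ℝ := deriv (fun v => h x v p) u

/-- Partial derivative with respect to `p`. -/
def partialP (h : ℝ → ℝ → ℝ → ℝ) (x u p : ℝ) : ℝ := deriv (fun q => h x u q) p

/-! ### Equilibria, linearization, hyperbolicity, Morse index -/

/-- `u` is an equilibrium of `u_t = a(x,u,u_x) u_xx + f(x,u,u_x)` on `[0, π]` with Neumann
boundary conditions. -/
def IsEquilibrium (a f : ℝ → ℝ → ℝ → ℝ) (u : I → ℝ) : Prop :=
  ContDiffOn ℝ 2 (onLine u) I ∧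
  D (onLine u) 0 = 0 ∧ D (onLine u) Real.pi = 0 ∧
  ∀ x ∈ I, a x (onLine u x) (D (onLine u) x) * D (D (onLine u)) x
    + f x (onLine u x) (D (onLine u) x) = 0

/-- The set of equilibria. -/
def equilibria (a f : ℝ → ℝ → ℝ → ℝ) : Set (I → ℝ) := {u | IsEquilibrium a f u}

/-- Coefficient of `φ_xx` in the linearization at `u`. -/
def linA (a : ℝ → ℝ → ℝ → ℝ) (u : I → ℝ) (x : ℝ) : ℝ :=
  a x (onLine u x) (D (onLine u) x)

/-- Coefficient of `φ` in the linearization at `u`. -/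
def linB (a f : ℝ → ℝ → ℝ → ℝ) (u : I → ℝ) (x : ℝ) : ℝ :=
  partialU a x (onLine u x) (D (onLine u) x) * D (D (onLine u)) x
    + partialU f x (onLine u x) (D (onLine u) x)

/-- Coefficient of `φ_x` in the linearization at `u`. -/
def linC (a f : ℝ → ℝ → ℝ → ℝ) (u : I → ℝ) (x : ℝ) : ℝ :=
  partialP a x (onLine u x) (D (onLine u) x) * D (D (onLine u)) x
    + partialP f x (onLine u x) (D (onLine u) x)

/-- `lam` is an eigenvalue of the linearization at `u`, with Neumann boundary conditions: there is
a complex-valued `C²` eigenfunction that does not vanish identically on `[0, π]`. -/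
def IsEigenvalue (a f : ℝ → ℝ → ℝ → ℝ) (u : I → ℝ) (lam : ℂ) : Prop :=
  ∃ φ : ℝ → ℂ, ContDiffOn ℝ 2 φ I ∧ (∃ x ∈ I, φ x ≠ 0) ∧
    D φ 0 = 0 ∧ D φ Real.pi = 0 ∧
    ∀ x ∈ I, (linA a u x : ℂ) * D (D φ) x + (linB a f u x : ℂ) * φ x
      + (linC a f u x : ℂ) * D φ x = lam * φ x

/-- No eigenvalue of the linearization lies on the imaginary axis. -/
def IsHyperbolic (a f : ℝ → ℝ → ℝ → ℝ) (u : I → ℝ) : Prop :=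
  ∀ lam : ℂ, lam.re = 0 → ¬ IsEigenvalue a f u lam

/-- The positive eigenvalues of the linearization at `u`. -/
def positiveEigenvalues (a f : ℝ → ℝ → ℝ → ℝ) (u : I → ℝ) : Set ℝ :=
  {lam | 0 < lam ∧ IsEigenvalue a f u (lam : ℂ)}

/-- The Morse index: the number of positive eigenvalues (`⊤` if there are infinitely many). -/
def morseIndex (a f : ℝ → ℝ → ℝ → ℝ) (u : I → ℝ) : ℕ∞ :=
  (positiveEigenvalues a f u).encard

/-! ### Shooting -/

/-- `w = (u, p)` solves `u_x = p`, `p_x = - f(x,u,p) / a(x,u,p)` on `[0, π]` with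
`(u, p)(0) = (b, 0)`. -/
def IsShootingSolution (a f : ℝ → ℝ → ℝ → ℝ) (b : ℝ) (w : ℝ → ℝ × ℝ) : Prop :=
  w 0 = (b, 0) ∧
  ∀ x ∈ I, HasDerivWithinAt w ((w x).2, -(f x (w x).1 (w x).2 / a x (w x).1 (w x).2)) I x

/-- The solution `x ↦ (u(x,b,0), p(x,b,0))` that starts at `(b, 0)`
(on `[0, π]` it is unique, and it is used only where it exists). -/
def shoot (a f : ℝ → ℝ → ℝ → ℝ) (b : ℝ) : ℝ → ℝ × ℝ :=
  Classical.epsilon (IsShootingSolution a f b)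

/-- The shooting manifold `M` in the space of all `(x, u, p)`. -/
def shootingManifold (a f : ℝ → ℝ → ℝ → ℝ) : Set (ℝ × ℝ × ℝ) :=
  {q | q.1 ∈ I ∧ ∃ b : ℝ, q.2 = shoot a f b q.1}

/-- The cross-section `M_x`. -/
def shootingCurve (a f : ℝ → ℝ → ℝ → ℝ) (x : ℝ) : Set (ℝ × ℝ × ℝ) :=
  {q | q ∈ shootingManifold a f ∧ q.1 = x}

/-- The Neumann line `L_x = {(x, b, 0)}`. -/
def neumannLine (x : ℝ) : Set (ℝ × ℝ × ℝ) := {q | ∃ b : ℝ, q = (x, b, 0)}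

/-- The curve `M_π`, parametrized by `b` in the `(u, p)`-plane over `x = π`, is transverse to
the `u`-axis `L_π` at parameter `b`: the two tangent directions span the plane. -/
def IsTransverseAt (a f : ℝ → ℝ → ℝ → ℝ) (b : ℝ) : Prop :=
  DifferentiableAt ℝ (fun β => shoot a f β Real.pi) b ∧
  Submodule.span ℝ {deriv (fun β => shoot a f β Real.pi) b, ((1 : ℝ), (0 : ℝ))} = ⊤

/-- `ζ` is the clockwise angle from `L_π` to `M_π` at parameter `b`: the tangent vectors to the
curves `M_x` along the trajectory of `b` are `ρ (cos ν, - sin ν)` with `ρ > 0` and `ν` continuous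
on `[0, π]`, `ν(0) = 0`, and `ζ = ν(π)`. -/
def IsClockwiseAngle (a f : ℝ → ℝ → ℝ → ℝ) (b ζ : ℝ) : Prop :=
  ∃ ν ρ : ℝ → ℝ, ContinuousOn ν I ∧ ν 0 = 0 ∧ ν Real.pi = ζ ∧
    ∀ x ∈ I, 0 < ρ x ∧
      HasDerivAt (fun β => shoot a f β x)
        (ρ x * Real.cos (ν x), -(ρ x * Real.sin (ν x))) b

end SturmShooting

end

/-! The key fact is that the variational equation of the shooting system along an equilibrium is its
linearized equation at eigenvalue parameter 0. Indeed `f = -a u''` on the equilibrium turns the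
derivative of `-f/a` into `-(β v + g v')` with `β = b_*/a_*` and `g = c_*/a_*`
(`IsEquilibrium.exists_linear_coefficients`). Hence `∂_b u` solves the linear equation with data
`(1, 0)` (`IsTrajectory.hasDerivAt_initial`), and in polar form its clockwise angle is a Prüfer
angle.

For real `l`, put `α = 1/a_*` and let `ν l` be the Prüfer angle for the coefficient `β - l α`. The
Neumann condition at `π` says `ν l π ∈ πℤ` (`hasNeumannSolution_ofReal_iff`), and `ζ = ν 0 π`. All
eigenvalues are real (`HasNeumannSolution.im_eq_zero`), so hyperbolicity only excludes 0, which is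
`sin ζ ≠ 0`, which is transversality.

For the Morse index, `l ↦ ν l π / π` is continuous (`continuous_pruferAngle_pi`), strictly
decreasing (`IsPruferAngle.lt_of_lt`), above `-1`, and nonpositive for some `l`. On `l > 0` it
therefore takes each of the values `0, …, ⌊ζ/π⌋` exactly once and no other integer
(`encard_integer_values`).

The equilibria themselves are the trajectories with `p = 0` at both ends, so the bijection is
uniqueness for the initial value problem. -/

namespace SturmShooting

open Set Filter Topology Metric
open scoped NNReal

/-! ### Uniqueness and differentiable dependence on initial values. -/

section ODE

variable {E G : Type*} [NormedAddCommGroup E] [NormedSpace ℝ E]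
  [NormedAddCommGroup G] [NormedSpace ℝ G]

theorem uniqueDiffOn_I : UniqueDiffOn ℝ I := uniqueDiffOn_Icc Real.pi_pos

theorem zero_mem_I : (0 : ℝ) ∈ I := ⟨le_rfl, Real.pi_pos.le⟩

theorem pi_mem_I : Real.pi ∈ I := ⟨Real.pi_pos.le, le_rfl⟩

theorem hasDerivWithinAt_Ici_of_I {w : ℝ → E} {w' : E} {x : ℝ} (h : HasDerivWithinAt w w' I x)
    (hx : x ∈ Ico 0 Real.pi) : HasDerivWithinAt w w' (Ici x) x :=
  h.mono_of_mem_nhdsWithin (Icc_mem_nhdsGE_of_mem hx)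

theorem hasDerivWithinAt_Iic_of_I {w : ℝ → E} {w' : E} {x : ℝ} (h : HasDerivWithinAt w w' I x)
    (hx : x ∈ Ioc 0 Real.pi) : HasDerivWithinAt w w' (Iic x) x :=
  h.mono_of_mem_nhdsWithin (Icc_mem_nhdsLE_of_mem hx)

/-- The derivative of `v ↦ H (x, v)` at `v`, read off from the derivative of `H` within
`[0, π] × E`. -/
noncomputable def sliceFDeriv (H : ℝ × E → G) (q : ℝ × E) : E →L[ℝ] G :=
  (fderivWithin ℝ H (I ×ˢ univ) q).comp (ContinuousLinearMap.inr ℝ ℝ E)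

theorem hasFDerivAt_slice {H : ℝ × E → G} (hH : ContDiffOn ℝ 1 H (I ×ˢ univ)) {x : ℝ}
    (hx : x ∈ I) (v : E) : HasFDerivAt (fun v => H (x, v)) (sliceFDeriv H (x, v)) v := by
  have h1 : HasFDerivWithinAt H (fderivWithin ℝ H (I ×ˢ univ) (x, v)) (I ×ˢ univ) (x, v) :=
    ((hH.differentiableOn one_ne_zero) (x, v) ⟨hx, mem_univ _⟩).hasFDerivWithinAt
  have h2 : HasFDerivWithinAt (fun v : E => (x, v)) (ContinuousLinearMap.inr ℝ ℝ E) univ v :=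
    (hasFDerivAt_prodMk_right x v).hasFDerivWithinAt
  exact hasFDerivWithinAt_univ.1 (h1.comp v h2 fun y _ => ⟨hx, mem_univ _⟩)

theorem continuousOn_sliceFDeriv {H : ℝ × E → G} (hH : ContDiffOn ℝ 1 H (I ×ˢ univ)) :
    ContinuousOn (sliceFDeriv H) (I ×ˢ univ) :=
  (hH.continuousOn_fderivWithin (uniqueDiffOn_I.prod uniqueDiffOn_univ) le_rfl).clm_comp
    continuousOn_const

/-- A `C¹` vector field is differentiable along a trajectory, uniformly on `[0, π]`. -/
theorem exists_uniform_linear_approx [ProperSpace E] {H : ℝ × E → G}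
    (hH : ContDiffOn ℝ 1 H (I ×ˢ univ)) {w : ℝ → E} (hw : ContinuousOn w I) {η : ℝ} (hη : 0 < η) :
    ∃ δ > 0, ∀ x ∈ I, ∀ h : E, ‖h‖ ≤ δ →
      ‖H (x, w x + h) - H (x, w x) - sliceFDeriv H (x, w x) h‖ ≤ η * ‖h‖ := by
  obtain ⟨R, hR⟩ := (isCompact_Icc (a := (0 : ℝ)) (b := Real.pi)).exists_bound_of_continuousOn hw
  have hK : IsCompact (I ×ˢ closedBall (0 : E) (R + 1)) := isCompact_Icc.prod
    (isCompact_closedBall _ _)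
  have huc := hK.uniformContinuousOn_of_continuous
    ((continuousOn_sliceFDeriv hH).mono (prod_mono_right (subset_univ _)))
  obtain ⟨δ, hδ, hd⟩ := Metric.uniformContinuousOn_iff.1 huc η hη
  -- The bound 1 keeps the segment in the ball of radius `R + 1`; `δ / 2` gives the strict
  -- inequality of uniform continuity. The claim is then the mean value inequality.
  refine ⟨min (δ / 2) 1, by positivity, fun x hx h hh => ?_⟩
  have hconv := (convex_closedBall (w x) (min (δ / 2) 1))
  have := hconv.norm_image_sub_le_of_norm_hasFDerivWithin_le'
    (f := fun v => H (x, v)) (f' := fun v => sliceFDeriv H (x, v)) (φ := sliceFDeriv H (x, w x))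
    (C := η) (x := w x) (y := w x + h)
    (fun v _ => (hasFDerivAt_slice hH hx v).hasFDerivWithinAt) ?_
    (mem_closedBall_self (by positivity)) (by simpa [mem_closedBall, dist_eq_norm] using hh)
  · simpa using this
  · intro v hv
    rw [mem_closedBall] at hv
    have hv1 : ‖v‖ ≤ R + 1 := by
      have : ‖v‖ ≤ ‖v - w x‖ + ‖w x‖ := by simpa using norm_add_le (v - w x) (w x)
      rw [dist_eq_norm] at hv
      have := hR x hx
      have := min_le_right (δ / 2) 1
      linarith
    have := hd (x, v) ⟨hx, by simpa using hv1⟩ (x, w x)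
      ⟨hx, by simpa using (hR x hx).trans (by linarith)⟩ ?_
    · rw [dist_eq_norm] at this; exact this.le
    · rw [Prod.dist_eq]
      simp only [dist_self]
      refine max_lt hδ (hv.trans_lt ((min_le_left _ _).trans_lt (by linarith)))

/-- Solutions on `[0, π]` of `w' = H (x, w)`. -/
def IsTrajectory (H : ℝ × E → E) (w : ℝ → E) : Prop :=
  ∀ x ∈ I, HasDerivWithinAt w (H (x, w x)) I x

theorem IsTrajectory.continuousOn {H : ℝ × E → E} {w : ℝ → E} (hw : IsTrajectory H w) :
    ContinuousOn w I := fun x hx => (hw x hx).continuousWithinAt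

/-- Two trajectories stay in a common ball, where a `C¹` field is Lipschitz by compactness. No
global Lipschitz bound is available. -/
theorem IsTrajectory.exists_lipschitz [ProperSpace E] {H : ℝ × E → E}
    (hH : ContDiffOn ℝ 1 H (I ×ˢ univ)) {w z : ℝ → E} (hw : IsTrajectory H w)
    (hz : IsTrajectory H z) : ∃ (K : ℝ≥0) (R : ℝ), (∀ x ∈ I, w x ∈ closedBall (0 : E) R) ∧
      (∀ x ∈ I, z x ∈ closedBall (0 : E) R) ∧
      ∀ x ∈ I, LipschitzOnWith K (fun v => H (x, v)) (closedBall (0 : E) R) := by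
  obtain ⟨R, hR⟩ := (isCompact_Icc (a := (0 : ℝ)) (b := Real.pi)).exists_bound_of_continuousOn
    hw.continuousOn
  obtain ⟨S, hS⟩ := (isCompact_Icc (a := (0 : ℝ)) (b := Real.pi)).exists_bound_of_continuousOn
    hz.continuousOn
  obtain ⟨K, hK⟩ := (hH.mono (prod_mono_right (subset_univ (closedBall (0 : E) (max R S))))
    ).exists_lipschitzOnWith one_ne_zero ((convex_Icc _ _).prod (convex_closedBall _ _))
    (isCompact_Icc.prod (isCompact_closedBall _ _))
  refine ⟨K, max R S, fun x hx => by simpa using Or.inl (hR x hx),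
    fun x hx => by simpa using Or.inr (hS x hx), fun x hx u hu v hv => ?_⟩
  simpa [Prod.edist_eq] using hK (x := (x, u)) ⟨hx, hu⟩ (y := (x, v)) ⟨hx, hv⟩

theorem IsTrajectory.eqOn_of_eq_zero [ProperSpace E] {H : ℝ × E → E}
    (hH : ContDiffOn ℝ 1 H (I ×ˢ univ)) {w z : ℝ → E} (hw : IsTrajectory H w)
    (hz : IsTrajectory H z) (h0 : w 0 = z 0) : EqOn w z I := by
  obtain ⟨K, R, hwR, hzR, hL⟩ := hw.exists_lipschitz hH hz
  have hsub : ∀ {t : ℝ}, t ∈ Ico 0 Real.pi → t ∈ I := fun h => Ico_subset_Icc_self h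
  exact ODE_solution_unique_of_mem_Icc_right (s := fun _ => closedBall (0 : E) R)
    (v := fun x v => H (x, v)) (fun t ht => hL t (hsub ht))
    hw.continuousOn (fun t ht => hasDerivWithinAt_Ici_of_I (hw t (hsub ht)) ht)
    (fun t ht => hwR t (hsub ht))
    hz.continuousOn (fun t ht => hasDerivWithinAt_Ici_of_I (hz t (hsub ht)) ht)
    (fun t ht => hzR t (hsub ht)) h0

theorem IsTrajectory.eqOn_of_eq_pi [ProperSpace E] {H : ℝ × E → E}
    (hH : ContDiffOn ℝ 1 H (I ×ˢ univ)) {w z : ℝ → E} (hw : IsTrajectory H w)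
    (hz : IsTrajectory H z) (hpi : w Real.pi = z Real.pi) : EqOn w z I := by
  obtain ⟨K, R, hwR, hzR, hL⟩ := hw.exists_lipschitz hH hz
  have hsub : ∀ {t : ℝ}, t ∈ Ioc 0 Real.pi → t ∈ I := fun h => Ioc_subset_Icc_self h
  exact ODE_solution_unique_of_mem_Icc_left (s := fun _ => closedBall (0 : E) R)
    (v := fun x v => H (x, v)) (fun t ht => hL t (hsub ht))
    hw.continuousOn (fun t ht => hasDerivWithinAt_Iic_of_I (hw t (hsub ht)) ht)
    (fun t ht => hwR t (hsub ht))
    hz.continuousOn (fun t ht => hasDerivWithinAt_Iic_of_I (hz t (hsub ht)) ht)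
    (fun t ht => hzR t (hsub ht)) hpi

/-- Lipschitz dependence on the initial value, near a given trajectory. -/
theorem IsTrajectory.exists_dist_le [ProperSpace E] {H : ℝ × E → E}
    (hH : ContDiffOn ℝ 1 H (I ×ˢ univ)) {w : ℝ → E} (hw : IsTrajectory H w) :
    ∃ r > 0, ∃ C > 0, ∀ z, IsTrajectory H z → ‖z 0 - w 0‖ ≤ r → ∀ x ∈ I,
      ‖z x - w x‖ ≤ C * ‖z 0 - w 0‖ := by
  obtain ⟨δ, hδ, hd⟩ := exists_uniform_linear_approx hH hw.continuousOn one_pos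
  have hcA : ContinuousOn (fun x => sliceFDeriv H (x, w x)) I :=
    (continuousOn_sliceFDeriv hH).comp (continuousOn_id.prodMk hw.continuousOn)
      fun x hx => ⟨hx, mem_univ _⟩
  obtain ⟨M, hM⟩ := (isCompact_Icc (a := (0 : ℝ)) (b := Real.pi)).exists_bound_of_continuousOn hcA
  have hM0 : 0 ≤ M := (norm_nonneg _).trans (hM 0 zero_mem_I)
  -- With `η = 1` the difference grows at rate at most `M + 1`; the barrier argument needs a
  -- strictly larger rate.
  set L := M + 2 with hL
  have hexp : ∀ x ∈ I, Real.exp (L * x) ≤ Real.exp (L * Real.pi) := fun x hx =>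
    Real.exp_le_exp.2 (mul_le_mul_of_nonneg_left hx.2 (by positivity))
  -- This radius keeps the barrier `r e^{Lx}` below `δ` up to `x = π`, so the linear approximation
  -- is valid wherever the barrier is touched.
  refine ⟨δ * Real.exp (-(L * Real.pi)), by positivity, Real.exp (L * Real.pi),
    Real.exp_pos _, fun z hz h0 x hx => ?_⟩
  rcases eq_or_ne (z 0) (w 0) with h | h
  · rw [hz.eqOn_of_eq_zero hH hw h hx, h]; simp
  set r := ‖z 0 - w 0‖ with hr
  have hr0 : 0 < r := norm_pos_iff.2 (sub_ne_zero.2 h)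
  have hbd : ∀ x ∈ I, r * Real.exp (L * x) ≤ δ := fun x hx => by
    calc r * Real.exp (L * x) ≤ (δ * Real.exp (-(L * Real.pi))) * Real.exp (L * Real.pi) :=
          mul_le_mul h0 (hexp x hx) (Real.exp_pos _).le (by positivity)
      _ = δ := by rw [mul_assoc, ← Real.exp_add]; simp
  have key := image_norm_le_of_norm_deriv_right_lt_deriv_boundary
    (f := fun x => z x - w x) (f' := fun x => H (x, z x) - H (x, w x))
    (a := 0) (b := Real.pi) (B := fun x => r * Real.exp (L * x))
    (B' := fun x => r * (Real.exp (L * x) * (L * 1)))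
    (hz.continuousOn.sub hw.continuousOn)
    (fun x hx => hasDerivWithinAt_Ici_of_I
      ((hz x (Ico_subset_Icc_self hx)).sub (hw x (Ico_subset_Icc_self hx))) hx)
    (by simp [hr])
    (fun x => (((hasDerivAt_id x).const_mul L).exp).const_mul r) ?_ hx
  · refine key.trans ?_
    rw [mul_comm]
    exact mul_le_mul_of_nonneg_right (hexp x hx) hr0.le
  · intro x hx heq
    have hxI : x ∈ I := Ico_subset_Icc_self hx
    have h1 := hd x hxI (z x - w x) (heq.le.trans (hbd x hxI))
    rw [add_sub_cancel, one_mul] at h1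
    have h2 : ‖sliceFDeriv H (x, w x) (z x - w x)‖ ≤ M * ‖z x - w x‖ :=
      (sliceFDeriv H (x, w x)).le_of_opNorm_le (hM x hxI) _
    have h3 := norm_le_insert' (H (x, z x) - H (x, w x)) (sliceFDeriv H (x, w x) (z x - w x))
    have h4 : 0 < r * Real.exp (L * x) := by positivity
    rw [heq] at h1 h2
    have : r * (Real.exp (L * x) * (L * 1)) = L * (r * Real.exp (L * x)) := by ring
    rw [this, hL]
    nlinarith

/-- A trajectory depends differentiably on its initial value, and the derivative solves the
variational equation. -/
theorem IsTrajectory.hasDerivAt_initial [ProperSpace E] {H : ℝ × E → E}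
    (hH : ContDiffOn ℝ 1 H (I ×ˢ univ)) {w : ℝ → ℝ → E} (hw : ∀ β, IsTrajectory H (w β))
    {b : ℝ} {e : E} (he : ∀ β, w β 0 - w b 0 = (β - b) • e) {V : ℝ → E} (hV0 : V 0 = e)
    (hV : ∀ x ∈ I, HasDerivWithinAt V (sliceFDeriv H (x, w b x) (V x)) I x) {x : ℝ} (hx : x ∈ I) :
    HasDerivAt (fun β => w β x) (V x) b := by
  obtain ⟨r, hr, C, hC, hdist⟩ := (hw b).exists_dist_le hH
  have hcA : ContinuousOn (fun x => sliceFDeriv H (x, w b x)) I :=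
    (continuousOn_sliceFDeriv hH).comp (continuousOn_id.prodMk (hw b).continuousOn)
      fun x hx => ⟨hx, mem_univ _⟩
  obtain ⟨M, hM⟩ := (isCompact_Icc (a := (0 : ℝ)) (b := Real.pi)).exists_bound_of_continuousOn hcA
  have hM0 : 0 ≤ M := (norm_nonneg _).trans (hM 0 zero_mem_I)
  set N := M + 1
  have hN : 0 < N := by positivity
  rw [hasDerivAt_iff_isLittleO, Asymptotics.isLittleO_iff]
  intro c hc
  -- `Q - 1` is the factor that Gronwall's inequality puts in front of `η ‖β - b‖`; the summand 1
  -- makes `Q` positive, so `η = c / Q` makes sense.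
  set Q := C * ‖e‖ / N * (Real.exp (N * Real.pi) - 1) + 1 with hQ
  have hexp : 1 ≤ Real.exp (N * Real.pi) := Real.one_le_exp (by positivity)
  have hQ0 : 0 < Q := by
    have : 0 ≤ C * ‖e‖ / N * (Real.exp (N * Real.pi) - 1) :=
      mul_nonneg (by positivity) (by linarith)
    linarith
  set η := c / Q with hη
  have hη0 : 0 < η := by positivity
  obtain ⟨δ, hδ, hd⟩ := exists_uniform_linear_approx hH (hw b).continuousOn hη0
  have hsmall : ∀ᶠ β in 𝓝 b, C * ‖(β - b) • e‖ ≤ δ ∧ ‖(β - b) • e‖ ≤ r := by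
    have h1 : Tendsto (fun β : ℝ => ‖(β - b) • e‖) (𝓝 b) (𝓝 0) := by
      have : Continuous (fun β : ℝ => ‖(β - b) • e‖) := by fun_prop
      simpa using this.tendsto b
    have h2 : Tendsto (fun β : ℝ => C * ‖(β - b) • e‖) (𝓝 b) (𝓝 0) := by
      simpa using h1.const_mul C
    exact (h2.eventually_le_const hδ).and (h1.eventually_le_const hr)
  filter_upwards [hsmall] with β hβ
  have hdb : ∀ y ∈ I, ‖w β y - w b y‖ ≤ C * ‖(β - b) • e‖ := fun y hy => by
    have := hdist (w β) (hw β) (by rw [he]; exact hβ.2) y hy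
    rwa [he] at this
  have key := norm_le_gronwallBound_of_norm_deriv_right_le
    (f := fun y => w β y - w b y - (β - b) • V y)
    (f' := fun y => H (y, w β y) - H (y, w b y) - (β - b) • sliceFDeriv H (y, w b y) (V y))
    (δ := 0) (K := N) (ε := η * (C * ‖(β - b) • e‖)) (a := 0) (b := Real.pi)
    (((hw β).continuousOn.sub (hw b).continuousOn).sub
      (continuousOn_const.smul fun y hy => (hV y hy).continuousWithinAt))
    (fun y hy => hasDerivWithinAt_Ici_of_I (by
      have hy' : y ∈ I := Ico_subset_Icc_self hy
      exact ((hw β y hy').sub (hw b y hy')).sub ((hV y hy').const_smul (β - b))) hy)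
    (by simp [he, hV0]) ?_ x hx
  · rw [gronwallBound_of_K_ne_0 hN.ne'] at key
    refine key.trans ?_
    simp only [zero_mul, zero_add, sub_zero]
    have hexpx : Real.exp (N * x) ≤ Real.exp (N * Real.pi) :=
      Real.exp_le_exp.2 (mul_le_mul_of_nonneg_left hx.2 hN.le)
    rw [norm_smul]
    calc η * (C * (‖β - b‖ * ‖e‖)) / N * (Real.exp (N * x) - 1)
        ≤ η * (C * (‖β - b‖ * ‖e‖)) / N * (Real.exp (N * Real.pi) - 1) :=
          mul_le_mul_of_nonneg_left (by linarith) (by positivity)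
      _ = (η * ‖β - b‖) * (Q - 1) := by rw [hQ]; ring
      _ ≤ (η * ‖β - b‖) * Q := mul_le_mul_of_nonneg_left (by linarith) (by positivity)
      _ = c * ‖β - b‖ := by rw [hη]; field_simp
  · intro y hy
    have hy' : y ∈ I := Ico_subset_Icc_self hy
    have h1 := hd y hy' (w β y - w b y) ((hdb y hy').trans hβ.1)
    rw [add_sub_cancel] at h1
    -- Taylor remainder of the field, plus the linearization applied to the quantity being
    -- estimated.
    have h2 : H (y, w β y) - H (y, w b y) - (β - b) • sliceFDeriv H (y, w b y) (V y)
        = (H (y, w β y) - H (y, w b y) - sliceFDeriv H (y, w b y) (w β y - w b y))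
          + sliceFDeriv H (y, w b y) (w β y - w b y - (β - b) • V y) := by
      simp only [map_sub, map_smul]; abel
    rw [h2]
    refine (norm_add_le _ _).trans ?_
    have h3 := (sliceFDeriv H (y, w b y)).le_of_opNorm_le (hM y hy')
      (w β y - w b y - (β - b) • V y)
    have h4 := mul_le_mul_of_nonneg_left (hdb y hy') hη0.le
    have h5 := norm_nonneg (w β y - w b y - (β - b) • V y)
    have h6 : N * ‖w β y - w b y - (β - b) • V y‖ = M * ‖w β y - w b y - (β - b) • V y‖
      + ‖w β y - w b y - (β - b) • V y‖ := by simp only [N]; ring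
    linarith

end ODE

/-! ### The Prüfer angle: existence, comparison, dependence on the parameter. -/

section Prufer

theorem exists_bound_on_I {h : ℝ → ℝ} (hh : ContinuousOn h I) : ∃ M, ∀ x ∈ I, |h x| ≤ M :=
  isCompact_Icc.exists_bound_of_continuousOn hh

theorem exists_primitive {h : ℝ → ℝ} (hh : ContinuousOn h I) :
    ∃ P : ℝ → ℝ, P 0 = 0 ∧ ∀ x ∈ I, HasDerivWithinAt P (h x) I x := by
  refine ⟨fun x => ∫ t in (0 : ℝ)..x, h t, by simp, fun x hx => ?_⟩
  have : Fact (x ∈ Icc (0 : ℝ) Real.pi) := ⟨hx⟩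
  exact intervalIntegral.integral_hasDerivWithinAt_right
    ((hh.mono (uIcc_subset_Icc zero_mem_I hx)).intervalIntegrable)
    (hh.stronglyMeasurableAtFilter_nhdsWithin measurableSet_Icc x) (hh x hx)

/-- The right-hand side of the equation for the clockwise Prüfer angle of `v'' = -q v - g v'`. -/
noncomputable def pruferField (q g : ℝ → ℝ) (x ν : ℝ) : ℝ :=
  Real.sin ν ^ 2 + q x * Real.cos ν ^ 2 - g x * (Real.sin ν * Real.cos ν)

/-- `ν` is the clockwise Prüfer angle of the solution of `v'' = -q v - g v'`, `v 0 = 1`,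
`v' 0 = 0`. -/
def IsPruferAngle (q g ν : ℝ → ℝ) : Prop :=
  ν 0 = 0 ∧ ∀ x ∈ I, HasDerivWithinAt ν (pruferField q g x (ν x)) I x

theorem IsPruferAngle.continuousOn {q g ν : ℝ → ℝ} (h : IsPruferAngle q g ν) :
    ContinuousOn ν I := fun x hx => (h.2 x hx).continuousWithinAt

theorem pruferField_lipschitz {q g : ℝ → ℝ} {x M N : ℝ} (hq : |q x| ≤ M) (hg : |g x| ≤ N)
    (μ ν : ℝ) : |pruferField q g x μ - pruferField q g x ν| ≤ (2 + 2 * M + N) * |μ - ν| := by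
  have hd : ∀ t ∈ (univ : Set ℝ), HasDerivWithinAt (pruferField q g x)
      (2 * Real.sin t * Real.cos t + q x * (2 * Real.cos t * -Real.sin t)
        - g x * (Real.cos t * Real.cos t + Real.sin t * -Real.sin t)) univ t := fun t _ => by
    have h1 := (Real.hasDerivAt_sin t).pow 2
    have h2 := ((Real.hasDerivAt_cos t).pow 2).const_mul (q x)
    have h3 := ((Real.hasDerivAt_sin t).mul (Real.hasDerivAt_cos t)).const_mul (g x)
    have := ((h1.add h2).sub h3).hasDerivWithinAt (s := univ)
    refine this.congr_deriv ?_
    simp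
  have hb : ∀ t ∈ (univ : Set ℝ), ‖2 * Real.sin t * Real.cos t
      + q x * (2 * Real.cos t * -Real.sin t)
      - g x * (Real.cos t * Real.cos t + Real.sin t * -Real.sin t)‖ ≤ 2 + 2 * M + N := fun t _ => by
    have e : 2 * Real.sin t * Real.cos t + q x * (2 * Real.cos t * -Real.sin t)
      - g x * (Real.cos t * Real.cos t + Real.sin t * -Real.sin t)
      = Real.sin (2 * t) - q x * Real.sin (2 * t) - g x * Real.cos (2 * t) := by
      rw [Real.sin_two_mul, Real.cos_two_mul']; ring
    rw [e, Real.norm_eq_abs]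
    have h1 := Real.abs_sin_le_one (2 * t)
    have h2 : |q x * Real.sin (2 * t)| ≤ M := by
      rw [abs_mul]; exact (mul_le_of_le_one_right (abs_nonneg _) h1).trans hq
    have h3 : |g x * Real.cos (2 * t)| ≤ N := by
      rw [abs_mul]; exact (mul_le_of_le_one_right (abs_nonneg _) (Real.abs_cos_le_one _)).trans hg
    have hM : 0 ≤ M := (abs_nonneg _).trans hq
    rw [abs_le] at *
    constructor <;> linarith
  exact convex_univ.norm_image_sub_le_of_norm_hasDerivWithin_le hd hb (mem_univ ν) (mem_univ μ)

theorem abs_pruferField_le {q g : ℝ → ℝ} {x M N : ℝ} (hq : |q x| ≤ M) (hg : |g x| ≤ N) (ν : ℝ) :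
    |pruferField q g x ν| ≤ 1 + M + N := by
  have h1 := Real.sin_sq_add_cos_sq ν
  have h2 : |q x * Real.cos ν ^ 2| ≤ M := by
    rw [abs_mul, abs_of_nonneg (sq_nonneg (Real.cos ν))]
    exact (mul_le_of_le_one_right (abs_nonneg _) (Real.cos_sq_le_one ν)).trans hq
  have h3 : |g x * (Real.sin ν * Real.cos ν)| ≤ N := by
    rw [abs_mul, abs_mul]
    refine (mul_le_of_le_one_right (abs_nonneg _) ?_).trans hg
    exact mul_le_one₀ (Real.abs_sin_le_one ν) (abs_nonneg _) (Real.abs_cos_le_one ν)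
  have h4 := Real.sin_sq_le_one ν
  have h5 := sq_nonneg (Real.sin ν)
  unfold pruferField
  rw [abs_le] at *
  constructor <;> linarith

theorem exists_isPruferAngle {q g : ℝ → ℝ} (hq : ContinuousOn q I) (hg : ContinuousOn g I) :
    ∃ ν, IsPruferAngle q g ν := by
  obtain ⟨M, hM⟩ := exists_bound_on_I hq
  obtain ⟨N, hN⟩ := exists_bound_on_I hg
  have hM0 : 0 ≤ M := (abs_nonneg _).trans (hM 0 zero_mem_I)
  have hN0 : 0 ≤ N := (abs_nonneg _).trans (hN 0 zero_mem_I)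
  lift M to ℝ≥0 using hM0
  lift N to ℝ≥0 using hN0
  -- The field is bounded by `1 + M + N` at every angle, so a ball of radius `(1 + M + N) π` gives
  -- existence on all of `[0, π]`.
  have hpl : IsPicardLindelof (pruferField q g) (⟨0, zero_mem_I⟩ : Icc (0 : ℝ) Real.pi) 0
      ((1 + M + N) * NNReal.pi) 0 (1 + M + N) (2 + 2 * M + N) := by
    refine ⟨fun x hx => ?_, fun v _ => ?_, fun x hx v _ => ?_, ?_⟩
    · refine LipschitzOnWith.of_dist_le_mul fun u _ v _ => ?_
      simpa [Real.dist_eq] using pruferField_lipschitz (hM x hx) (hN x hx) u v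
    · unfold pruferField; fun_prop
    · simpa using abs_pruferField_le (hM x hx) (hN x hx) v
    · simp [Real.pi_pos.le, NNReal.coe_real_pi]
  obtain ⟨ν, h0, hν⟩ := hpl.exists_eq_forall_mem_Icc_hasDerivWithinAt₀
  exact ⟨ν, h0, hν⟩

/-- The solution of `v'' = -q v - g v'`, `v 0 = 1`, `v' 0 = 0` in polar form. -/
theorem IsPruferAngle.exists_radius {q g ν : ℝ → ℝ} (hq : ContinuousOn q I)
    (hg : ContinuousOn g I) (hν : IsPruferAngle q g ν) :
    ∃ ρ : ℝ → ℝ, ρ 0 = 1 ∧ (∀ x, 0 < ρ x) ∧ ∀ x ∈ I,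
      HasDerivWithinAt (fun x => ρ x * Real.cos (ν x)) (-(ρ x * Real.sin (ν x))) I x ∧
      HasDerivWithinAt (fun x => -(ρ x * Real.sin (ν x)))
        (-(q x * (ρ x * Real.cos (ν x)) + g x * -(ρ x * Real.sin (ν x)))) I x := by
  have hνc := hν.continuousOn
  -- The integrand is `ρ'/ρ`, obtained from `ρ ρ' = v v' + v' v''`.
  obtain ⟨P, hP0, hP⟩ := exists_primitive
    (h := fun x => -(Real.sin (ν x) * Real.cos (ν x)) + q x * (Real.sin (ν x) * Real.cos (ν x))
      - g x * Real.sin (ν x) ^ 2) (by fun_prop)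
  refine ⟨fun x => Real.exp (P x), by simp [hP0], fun x => Real.exp_pos _, fun x hx => ⟨?_, ?_⟩⟩
  · refine ((hP x hx).exp.mul (hν.2 x hx).cos).congr_deriv ?_
    have := Real.sin_sq_add_cos_sq (ν x)
    unfold pruferField
    linear_combination (-Real.exp (P x) * Real.sin (ν x)) * this
  · refine ((hP x hx).exp.mul (hν.2 x hx).sin).neg.congr_deriv ?_
    have := Real.sin_sq_add_cos_sq (ν x)
    unfold pruferField
    linear_combination (-Real.exp (P x) * (q x * Real.cos (ν x) - g x * Real.sin (ν x))) * this

/-- If `d' ≥ -K |d|` and `d 0 ≥ 0`, then `e^{K x} d x` is at least `d 0` and nondecreasing. -/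
theorem monotoneOn_exp_mul_of_deriv_ge {d d' : ℝ → ℝ} {K : ℝ} (hK : 0 < K)
    (hd : ∀ x ∈ I, HasDerivWithinAt d (d' x) I x) (hd' : ∀ x ∈ I, -(K * |d x|) ≤ d' x)
    (h0 : 0 ≤ d 0) : (∀ x ∈ I, 0 ≤ d x) ∧ MonotoneOn (fun x => Real.exp (K * x) * d x) I := by
  have hc : ContinuousOn d I := fun x hx => (hd x hx).continuousWithinAt
  have hnn : ∀ x ∈ I, 0 ≤ d x := by
    intro x hx
    refine le_of_forall_pos_le_add fun ε hε => ?_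
    -- The barrier `η e^{2Ky}` for `-d` equals `ε` at `y = x`; its rate `2K` strictly exceeds the
    -- allowed rate `K`.
    set η := ε * Real.exp (-(2 * K * x))
    have hη : 0 < η := by positivity
    have key := image_le_of_deriv_right_lt_deriv_boundary (f := fun x => -d x)
      (f' := fun x => -d' x) (a := 0) (b := Real.pi) (B := fun x => η * Real.exp (2 * K * x))
      (B' := fun x => η * (Real.exp (2 * K * x) * (2 * K * 1))) hc.neg
      (fun y hy => hasDerivWithinAt_Ici_of_I (hd y (Ico_subset_Icc_self hy)).neg hy)
      (by simp; linarith)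
      (fun y => (((hasDerivAt_id y).const_mul (2 * K)).exp).const_mul η) ?_ hx
    · simp only [η, mul_assoc, ← Real.exp_add] at key
      simp at key
      linarith
    · intro y hy heq
      have h1 := hd' y (Ico_subset_Icc_self hy)
      have h2 : 0 < η * Real.exp (2 * K * y) := by positivity
      rw [← abs_neg, heq, abs_of_pos h2] at h1
      have h3 : 0 < K * (η * Real.exp (2 * K * y)) := by positivity
      linarith
  refine ⟨hnn, ?_⟩
  have hder : ∀ x ∈ I, HasDerivWithinAt (fun x => Real.exp (K * x) * d x)
      (Real.exp (K * x) * (K * d x + d' x)) I x := fun x hx => by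
    have h1 : HasDerivWithinAt (fun x : ℝ => Real.exp (K * x)) (Real.exp (K * x) * (K * 1)) I x :=
      ((hasDerivAt_id x).const_mul K).exp.hasDerivWithinAt
    exact (h1.mul (hd x hx)).congr_deriv (by ring)
  refine monotoneOn_of_hasDerivWithinAt_nonneg (convex_Icc _ _)
    (fun x hx => (hder x hx).continuousWithinAt)
    (fun x hx => (hder x (interior_subset hx)).mono interior_subset) fun x hx => ?_
  have h1 := hd' x (interior_subset hx)
  rw [abs_of_nonneg (hnn x (interior_subset hx))] at h1
  exact mul_nonneg (Real.exp_pos _).le (by linarith)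

section Compare

variable {q r g ν μ : ℝ → ℝ}

theorem exists_pruferField_lipschitz (hq : ContinuousOn q I) (hg : ContinuousOn g I) :
    ∃ K > 0, ∀ x ∈ I, ∀ s t, |pruferField q g x s - pruferField q g x t| ≤ K * |s - t| := by
  obtain ⟨M, hM⟩ := exists_bound_on_I hq
  obtain ⟨N, hN⟩ := exists_bound_on_I hg
  have hM0 : 0 ≤ M := (abs_nonneg _).trans (hM 0 zero_mem_I)
  have hN0 : 0 ≤ N := (abs_nonneg _).trans (hN 0 zero_mem_I)
  exact ⟨2 + 2 * M + N, by positivity, fun x hx => pruferField_lipschitz (hM x hx) (hN x hx)⟩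

/-- At the angle `-π/2` the field equals 1 whatever `q` and `g` are, so this level cannot be crossed
downwards. -/
theorem IsPruferAngle.neg_half_pi_lt (hq : ContinuousOn q I) (hg : ContinuousOn g I)
    (hν : IsPruferAngle q g ν) : -(Real.pi / 2) < ν Real.pi := by
  obtain ⟨K, hK, hL⟩ := exists_pruferField_lipschitz hq hg
  have hm := (monotoneOn_exp_mul_of_deriv_ge (d := fun x => ν x + Real.pi / 2) hK
    (fun x hx => (hν.2 x hx).add_const _) (fun x hx => by
      have := hL x hx (ν x) (-(Real.pi / 2))
      rw [sub_neg_eq_add] at this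
      have e : pruferField q g x (-(Real.pi / 2)) = 1 := by simp [pruferField]
      rw [e] at this
      have := neg_le_of_abs_le this
      linarith) (by rw [hν.1]; have := Real.pi_pos; positivity)).2 zero_mem_I pi_mem_I
      Real.pi_pos.le
  have hpi := Real.pi_pos
  simp only [mul_zero, Real.exp_zero, hν.1, one_mul, zero_add] at hm
  have : 0 < ν Real.pi + Real.pi / 2 :=
    pos_of_mul_pos_right (lt_of_lt_of_le (by positivity) hm) (Real.exp_pos _).le
  linarith

/-- At the angle 0 the field equals `q ≤ 0`, so the angle cannot become positive. -/
theorem IsPruferAngle.nonpos (hq : ContinuousOn q I) (hg : ContinuousOn g I)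
    (hν : IsPruferAngle q g ν) (hq0 : ∀ x ∈ I, q x ≤ 0) : ν Real.pi ≤ 0 := by
  obtain ⟨K, hK, hL⟩ := exists_pruferField_lipschitz hq hg
  have := (monotoneOn_exp_mul_of_deriv_ge (d := fun x => -ν x) hK
    (fun x hx => (hν.2 x hx).neg) (fun x hx => by
      have := hL x hx (ν x) 0
      have e : pruferField q g x 0 = q x := by simp [pruferField]
      rw [e, sub_zero] at this
      have := le_of_abs_le this
      have := hq0 x hx
      rw [abs_neg]
      linarith) (by simp [hν.1])).1 _ pi_mem_I
  linarith

theorem pruferField_sub (x t : ℝ) :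
    pruferField q g x t - pruferField r g x t = (q x - r x) * Real.cos t ^ 2 := by
  unfold pruferField; ring

/-- Sturm comparison. The fields differ by `(q - r) cos² ≥ 0`, which may vanish at some angles;
strictness comes from `x = 0`, where the cosine is 1. -/
theorem IsPruferAngle.lt_of_lt (hq : ContinuousOn q I) (hg : ContinuousOn g I)
    (hν : IsPruferAngle q g ν) (hμ : IsPruferAngle r g μ) (hrq : ∀ x ∈ I, r x < q x) :
    μ Real.pi < ν Real.pi := by
  obtain ⟨K, hK, hL⟩ := exists_pruferField_lipschitz hq hg
  have hd : ∀ x ∈ I, HasDerivWithinAt (fun x => ν x - μ x)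
    (pruferField q g x (ν x) - pruferField r g x (μ x)) I x :=
      fun x hx => (hν.2 x hx).sub (hμ.2 x hx)
  obtain ⟨hnn, hmono⟩ := monotoneOn_exp_mul_of_deriv_ge (d := fun x => ν x - μ x) hK
    hd (fun x hx => by
      have h1 := neg_le_of_abs_le (hL x hx (ν x) (μ x))
      have h2 := pruferField_sub (q := q) (r := r) (g := g) x (μ x)
      have h3 := mul_nonneg (sub_nonneg.2 (hrq x hx).le) (sq_nonneg (Real.cos (μ x)))
      linarith) (by simp [hν.1, hμ.1])
  by_contra! hle
  -- The weighted difference is nonnegative, nondecreasing and nonpositive at `π`, hence zero; but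
  -- its derivative at 0 is `q 0 - r 0 > 0`.
  have hz : ∀ x ∈ I, ν x - μ x = 0 := fun x hx => by
    refine le_antisymm ?_ (hnn x hx)
    have h1 : Real.exp (K * x) * (ν x - μ x) ≤ Real.exp (K * Real.pi) * (ν Real.pi - μ Real.pi) :=
      hmono hx pi_mem_I hx.2
    have h2 : Real.exp (K * Real.pi) * (ν Real.pi - μ Real.pi) ≤ 0 :=
      mul_nonpos_of_nonneg_of_nonpos (Real.exp_pos _).le (by linarith)
    exact nonpos_of_mul_nonpos_right (h1.trans h2) (Real.exp_pos _)
  have h0 : HasDerivWithinAt (fun x => ν x - μ x) 0 I 0 :=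
    (hasDerivWithinAt_const 0 I (0 : ℝ)).congr hz (hz 0 zero_mem_I)
  have := (uniqueDiffOn_I 0 zero_mem_I).eq_deriv I h0 (hd 0 zero_mem_I)
  rw [hν.1, hμ.1, pruferField_sub] at this
  have := hrq 0 zero_mem_I
  simp at *
  linarith

end Compare

/-- Passing from `l` to `m` perturbs the field by at most `|m - l| sup |α|`; Gronwall's inequality,
with the Lipschitz constant at the fixed `l`, does the rest. -/
theorem continuous_pruferAngle_pi {α β g : ℝ → ℝ} (hα : ContinuousOn α I)
    (hβ : ContinuousOn β I) (hg : ContinuousOn g I) {ν : ℝ → ℝ → ℝ}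
    (hν : ∀ l, IsPruferAngle (fun x => β x - l * α x) g (ν l)) :
    Continuous fun l => ν l Real.pi := by
  obtain ⟨A, hA⟩ := exists_bound_on_I hα
  rw [continuous_iff_continuousAt]
  intro l
  obtain ⟨K, hK, hL⟩ := exists_pruferField_lipschitz (q := fun x => β x - l * α x) (by fun_prop) hg
  have key : ∀ m, |ν m Real.pi - ν l Real.pi| ≤
      |m - l| * (A / K * (Real.exp (K * Real.pi) - 1)) := by
    intro m
    have := norm_le_gronwallBound_of_norm_deriv_right_le (f := fun x => ν m x - ν l x)
      (δ := 0) (K := K) (ε := |m - l| * A)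
      (f' := fun x => pruferField (fun x => β x - m * α x) g x (ν m x) -
        pruferField (fun x => β x - l * α x) g x (ν l x)) (a := 0) (b := Real.pi)
      ((hν m).continuousOn.sub (hν l).continuousOn)
      (fun x hx => hasDerivWithinAt_Ici_of_I (((hν m).2 x (Ico_subset_Icc_self hx)).sub
        ((hν l).2 x (Ico_subset_Icc_self hx))) hx) (by simp [(hν m).1, (hν l).1]) ?_ Real.pi pi_mem_I
    · rw [gronwallBound_of_K_ne_0 hK.ne'] at this
      simp only [zero_mul, zero_add, sub_zero, Real.norm_eq_abs] at this
      refine this.trans_eq (by ring)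
    · intro x hx
      have hx' : x ∈ I := Ico_subset_Icc_self hx
      have h1 := hL x hx' (ν m x) (ν l x)
      have h2 := pruferField_sub (q := fun x => β x - m * α x) (r := fun x => β x - l * α x)
        (g := g) x (ν m x)
      have h3 : |(β x - m * α x - (β x - l * α x)) * Real.cos (ν m x) ^ 2| ≤ |m - l| * A := by
        have e : β x - m * α x - (β x - l * α x) = -(m - l) * α x := by ring
        rw [e, abs_mul, abs_mul, abs_neg, abs_of_nonneg (sq_nonneg (Real.cos _))]
        refine (mul_le_of_le_one_right (by positivity) (Real.cos_sq_le_one _)).trans ?_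
        exact mul_le_mul_of_nonneg_left (hA x hx') (abs_nonneg _)
      rw [← h2] at h3
      rw [Real.norm_eq_abs, Real.norm_eq_abs]
      refine (abs_sub_le _ (pruferField (fun x => β x - l * α x) g x (ν m x)) _).trans ?_
      linarith
  refine tendsto_iff_dist_tendsto_zero.2 (squeeze_zero (fun _ => dist_nonneg) key ?_)
  have : Continuous fun m => |m - l| * (A / K * (Real.exp (K * Real.pi) - 1)) := by fun_prop
  simpa using this.tendsto l

/-- A continuous, strictly decreasing function that takes a nonpositive value, exceeds `-1` and is
not an integer at `0` takes exactly `1 + ⌊h 0⌋` integer values on the positive half-line. -/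
theorem encard_integer_values {h : ℝ → ℝ} (hc : Continuous h) (ha : StrictAnti h)
    (hlow : ∀ l, -1 < h l) {Λ : ℝ} (hΛ : h Λ ≤ 0) (h0 : ∀ k : ℤ, h 0 ≠ k) :
    ∃ n : ℕ, {l : ℝ | 0 < l ∧ ∃ k : ℤ, h l = k}.encard = n ∧ (n : ℤ) = 1 + ⌊h 0⌋ := by
  have hf : -1 ≤ ⌊h 0⌋ := Int.le_floor.2 (by simpa using (hlow 0).le)
  refine ⟨(1 + ⌊h 0⌋).toNat, ?_, Int.toNat_of_nonneg (by linarith)⟩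
  have hinj : InjOn (fun l => ⌊h l⌋) {l : ℝ | 0 < l ∧ ∃ k : ℤ, h l = k} := by
    rintro l ⟨_, k, hk⟩ m ⟨_, j, hj⟩ hlm
    apply ha.injective
    simp only [hk, hj, Int.floor_intCast] at hlm
    rw [hk, hj, hlm]
  rw [← hinj.encard_image]
  -- The bound `-1 < h` excludes negative integers, monotonicity those above `h 0`, and the
  -- intermediate value theorem on `[0, Λ]` yields the others. If `⌊h 0⌋ = -1`, both sides are
  -- empty.
  have himg : (fun l => ⌊h l⌋) '' {l : ℝ | 0 < l ∧ ∃ k : ℤ, h l = k}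
      = (Finset.Icc 0 ⌊h 0⌋ : Finset ℤ) := by
    ext k
    simp only [mem_image, mem_ofPred_eq, Finset.coe_Icc, mem_Icc]
    constructor
    · rintro ⟨l, ⟨hl, j, hj⟩, rfl⟩
      rw [hj, Int.floor_intCast]
      have h1 := hlow l
      rw [hj] at h1
      have h2 : (-1 : ℤ) < j := by exact_mod_cast h1
      refine ⟨by linarith, Int.le_floor.2 ?_⟩
      rw [← hj]; exact (ha hl).le
    · rintro ⟨hk0, hk⟩
      have h1 : (k : ℝ) < h 0 := lt_of_le_of_ne (Int.le_floor.1 hk) (h0 k).symm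
      have h2 : h Λ ≤ k := hΛ.trans (by exact_mod_cast hk0)
      have h3 : 0 ≤ Λ := by
        by_contra! hneg
        exact absurd (ha hneg) (by linarith)
      obtain ⟨l, hl, hlk⟩ := intermediate_value_Icc' h3 hc.continuousOn ⟨h2, h1.le⟩
      refine ⟨l, ⟨lt_of_le_of_ne hl.1 ?_, k, hlk⟩, by simp [hlk]⟩
      rintro rfl
      exact h0 k hlk
  rw [himg, Set.encard_coe_eq_coe_finsetCard, Int.card_Icc]
  congr 2
  ring

/-- A continuous function on `[0, π]` that starts at `0` and takes its values in `2πℤ` vanishes. -/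
theorem eq_zero_of_cos_eq_one {d : ℝ → ℝ} (hd : ContinuousOn d I) (h0 : d 0 = 0)
    (hcos : ∀ x ∈ I, Real.cos (d x) = 1) : d Real.pi = 0 := by
  by_contra hne
  have hpos : 0 < |d Real.pi| := abs_pos.2 hne
  -- A value of `|d|` in `(0, 1]` is not a multiple of `2π`.
  obtain ⟨x, hx, hxt⟩ := intermediate_value_Icc Real.pi_pos.le hd.abs
    (show min (|d Real.pi|) 1 ∈ Icc (|d 0|) (|d Real.pi|) from
      ⟨by simp [h0], min_le_left _ _⟩)
  have h1 : 0 < |d x| := by simp only at hxt; rw [hxt]; positivity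
  have h2 : |d x| ≤ 1 := by simp only at hxt; rw [hxt]; exact min_le_right _ _
  have h3 := hcos x hx
  rw [← Real.cos_abs] at h3
  have := (Real.cos_eq_one_iff_of_lt_of_lt (by linarith [Real.pi_pos])
    (by linarith [Real.pi_gt_three])).1 h3
  linarith

theorem cos_sub_eq_one_of_polar_eq {r s θ η : ℝ} (hr : 0 < r) (hs : 0 < s)
    (hcos : r * Real.cos θ = s * Real.cos η) (hsin : r * Real.sin θ = s * Real.sin η) :
    Real.cos (θ - η) = 1 := by
  have hθ := Real.sin_sq_add_cos_sq θ
  have hη := Real.sin_sq_add_cos_sq η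
  have hrs : r = s := by
    refine (sq_eq_sq₀ hr.le hs.le).1 ?_
    linear_combination (r * Real.cos θ + s * Real.cos η) * hcos
      + (r * Real.sin θ + s * Real.sin η) * hsin - r ^ 2 * hθ + s ^ 2 * hη
  subst hrs
  rw [mul_left_cancel_iff_of_pos hr] at hcos hsin
  rw [Real.cos_sub, hcos, hsin]
  linarith

end Prufer

/-! ### Eigenvalues of the linearization as a Neumann problem. -/

section Eigenvalues

theorem D_eq_of_hasDerivWithinAt {F : Type*} [NormedAddCommGroup F] [NormedSpace ℝ F]
    {φ : ℝ → F} {y : F} {x : ℝ} (hx : x ∈ I) (h : HasDerivWithinAt φ y I x) : D φ x = y :=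
  h.derivWithin (uniqueDiffOn_I x hx)

theorem contDiffOn_two_of_hasDerivWithinAt {F : Type*} [NormedAddCommGroup F] [NormedSpace ℝ F]
    {φ ψ χ : ℝ → F} (hφ : ∀ x ∈ I, HasDerivWithinAt φ (ψ x) I x)
    (hψ : ∀ x ∈ I, HasDerivWithinAt ψ (χ x) I x) (hχ : ContinuousOn χ I) :
    ContDiffOn ℝ 2 φ I ∧ EqOn (D φ) ψ I ∧ EqOn (D (D φ)) χ I := by
  have h1 : EqOn (D φ) ψ I := fun x hx => D_eq_of_hasDerivWithinAt hx (hφ x hx)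
  have h1' : ∀ x ∈ I, HasDerivWithinAt (D φ) (χ x) I x := fun x hx =>
    (hψ x hx).congr h1 (h1 hx)
  have h2 : EqOn (D (D φ)) χ I := fun x hx => D_eq_of_hasDerivWithinAt hx (h1' x hx)
  refine ⟨?_, h1, h2⟩
  rw [show (2 : WithTop ℕ∞) = 1 + 1 from one_add_one_eq_two.symm,
    contDiffOn_succ_iff_derivWithin uniqueDiffOn_I]
  refine ⟨fun x hx => (hφ x hx).differentiableWithinAt, by simp, ?_⟩
  rw [contDiffOn_one_iff_derivWithin uniqueDiffOn_I]
  exact ⟨fun x hx => (h1' x hx).differentiableWithinAt, hχ.congr h2⟩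

theorem hasDerivWithinAt_of_contDiffOn_two {F : Type*} [NormedAddCommGroup F] [NormedSpace ℝ F]
    {φ : ℝ → F} (hφ : ContDiffOn ℝ 2 φ I) :
    (∀ x ∈ I, HasDerivWithinAt φ (D φ x) I x) ∧
    (∀ x ∈ I, HasDerivWithinAt (D φ) (D (D φ) x) I x) ∧ ContinuousOn (D (D φ)) I := by
  rw [show (2 : WithTop ℕ∞) = 1 + 1 from one_add_one_eq_two.symm,
    contDiffOn_succ_iff_derivWithin uniqueDiffOn_I] at hφ
  obtain ⟨h1, -, h2⟩ := hφ
  rw [contDiffOn_one_iff_derivWithin uniqueDiffOn_I] at h2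
  exact ⟨fun x hx => (h1 x hx).hasDerivWithinAt, fun x hx => (h2.1 x hx).hasDerivWithinAt, h2.2⟩

/-- The Neumann problem for `φ'' = -(β - lam α) φ - g φ'` has a nontrivial solution. -/
def HasNeumannSolution (α β g : ℝ → ℝ) (lam : ℂ) : Prop :=
  ∃ φ ψ : ℝ → ℂ, (∃ x ∈ I, φ x ≠ 0) ∧ ψ 0 = 0 ∧ ψ Real.pi = 0 ∧ ∀ x ∈ I,
    HasDerivWithinAt φ (ψ x) I x ∧
    HasDerivWithinAt ψ (-((β x - lam * α x) * φ x + g x * ψ x)) I x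

theorem isEigenvalue_iff_hasNeumannSolution {a f : ℝ → ℝ → ℝ → ℝ} {u : I → ℝ} {α β g : ℝ → ℝ}
    (hα : ContinuousOn α I) (hβ : ContinuousOn β I) (hg : ContinuousOn g I)
    (hA : ∀ x ∈ I, linA a u x ≠ 0) (hαA : ∀ x ∈ I, linA a u x * α x = 1)
    (hβB : ∀ x ∈ I, linA a u x * β x = linB a f u x)
    (hgC : ∀ x ∈ I, linA a u x * g x = linC a f u x) (lam : ℂ) :
    IsEigenvalue a f u lam ↔ HasNeumannSolution α β g lam := by
  have cA : ∀ x ∈ I, (linA a u x : ℂ) ≠ 0 := fun x hx => by exact_mod_cast hA x hx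
  have cα : ∀ x ∈ I, (linA a u x : ℂ) * α x = 1 := fun x hx => by exact_mod_cast hαA x hx
  have cβ : ∀ x ∈ I, (linA a u x : ℂ) * β x = linB a f u x :=
    fun x hx => by exact_mod_cast hβB x hx
  have cg : ∀ x ∈ I, (linA a u x : ℂ) * g x = linC a f u x :=
    fun x hx => by exact_mod_cast hgC x hx
  constructor
  · rintro ⟨φ, hφ, hne, h0, hpi, heq⟩
    obtain ⟨h1, h2, -⟩ := hasDerivWithinAt_of_contDiffOn_two hφ
    refine ⟨φ, D φ, hne, h0, hpi, fun x hx => ⟨h1 x hx, (h2 x hx).congr_deriv ?_⟩⟩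
    apply mul_left_cancel₀ (cA x hx)
    linear_combination heq x hx + φ x * cβ x hx + D φ x * cg x hx - lam * φ x * cα x hx
  · rintro ⟨φ, ψ, hne, h0, hpi, h⟩
    have hφc : ContinuousOn φ I := fun x hx => (h x hx).1.continuousWithinAt
    have hψc : ContinuousOn ψ I := fun x hx => (h x hx).2.continuousWithinAt
    obtain ⟨h1, h2, h3⟩ := contDiffOn_two_of_hasDerivWithinAt (fun x hx => (h x hx).1)
      (fun x hx => (h x hx).2) (by
        have e : ∀ {k : ℝ → ℝ}, ContinuousOn k I → ContinuousOn (fun x => (k x : ℂ)) I :=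
          fun hk => Complex.continuous_ofReal.comp_continuousOn hk
        exact ((((e hβ).sub (continuousOn_const.mul (e hα))).mul hφc).add ((e hg).mul hψc)).neg)
    refine ⟨φ, h1, hne, by rw [h2 zero_mem_I, h0], by rw [h2 pi_mem_I, hpi], fun x hx => ?_⟩
    rw [h2 hx, h3 hx]
    linear_combination lam * φ x * cα x hx - φ x * cβ x hx - ψ x * cg x hx

/-- Gronwall's inequality for a linear system. It makes every complex eigenfunction with real
eigenvalue a multiple of the real polar solution. -/
theorem eq_zero_of_linear_of_eq_zero {q g : ℝ → ℝ} (hq : ContinuousOn q I) (hg : ContinuousOn g I)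
    {y z : ℝ → ℂ} (hy : ∀ x ∈ I, HasDerivWithinAt y (z x) I x)
    (hz : ∀ x ∈ I, HasDerivWithinAt z (-(q x * y x + g x * z x)) I x) (hy0 : y 0 = 0)
    (hz0 : z 0 = 0) : ∀ x ∈ I, y x = 0 ∧ z x = 0 := by
  obtain ⟨M, hM⟩ := exists_bound_on_I hq
  obtain ⟨N, hN⟩ := exists_bound_on_I hg
  have hM0 : 0 ≤ M := (abs_nonneg _).trans (hM 0 zero_mem_I)
  have hN0 : 0 ≤ N := (abs_nonneg _).trans (hN 0 zero_mem_I)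
  have hd : ∀ x ∈ I, HasDerivWithinAt (fun x => (y x, z x))
      (z x, -(q x * y x + g x * z x)) I x := fun x hx => (hy x hx).prodMk (hz x hx)
  have key := eq_zero_of_abs_deriv_le_mul_abs_self_of_eq_zero_right
    (f := fun x => (y x, z x)) (f' := fun x => (z x, -(q x * y x + g x * z x)))
    (K := 1 + M + N) (a := 0) (b := Real.pi) (fun x hx => (hd x hx).continuousWithinAt)
    (fun x hx => hasDerivWithinAt_Ici_of_I (hd x (Ico_subset_Icc_self hx)) hx)
    (by simp [hy0, hz0]) (fun x hx => by
      have hx' : x ∈ I := Ico_subset_Icc_self hx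
      have h1 : ‖y x‖ ≤ ‖(y x, z x)‖ := norm_fst_le (y x, z x)
      have h2 : ‖z x‖ ≤ ‖(y x, z x)‖ := norm_snd_le (y x, z x)
      rw [norm_prod_le_iff]
      constructor
      · refine h2.trans (le_mul_of_one_le_left (norm_nonneg _) (by linarith))
      · simp only [norm_neg]
        refine (norm_add_le _ _).trans ?_
        rw [norm_mul, norm_mul, Complex.norm_real, Complex.norm_real]
        have h3 := mul_le_mul (hM x hx') h1 (norm_nonneg _) hM0
        have h4 := mul_le_mul (hN x hx') h2 (norm_nonneg _) hN0
        have h5 := norm_nonneg (y x, z x)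
        simp only [Real.norm_eq_abs]
        linarith)
  intro x hx
  simpa using key x hx

/-- A real number is an eigenvalue if and only if the Prüfer angle at `π` is a multiple of `π`. -/
theorem hasNeumannSolution_ofReal_iff {α β g ν : ℝ → ℝ} (hα : ContinuousOn α I)
    (hβ : ContinuousOn β I) (hg : ContinuousOn g I) {l : ℝ}
    (hν : IsPruferAngle (fun x => β x - l * α x) g ν) :
    HasNeumannSolution α β g (l : ℂ) ↔ Real.sin (ν Real.pi) = 0 := by
  have hq : ContinuousOn (fun x => β x - l * α x) I := by fun_prop
  obtain ⟨ρ, hρ0, hρ, hder⟩ := hν.exists_radius hq hg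
  constructor
  · rintro ⟨φ, ψ, ⟨x₀, hx₀, hne⟩, h0, hpi, h⟩
    have key := eq_zero_of_linear_of_eq_zero hq hg
      (y := fun x => φ x - φ 0 * (ρ x * Real.cos (ν x) : ℝ))
      (z := fun x => ψ x - φ 0 * (-(ρ x * Real.sin (ν x)) : ℝ))
      (fun x hx => (h x hx).1.sub ((hder x hx).1.ofReal_comp.const_mul (φ 0)))
      (fun x hx => ((h x hx).2.sub ((hder x hx).2.ofReal_comp.const_mul (φ 0))).congr_deriv (by
        push_cast; ring)) (by simp [hρ0, hν.1]) (by simp [h0, hν.1])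
    have h00 : φ 0 ≠ 0 := fun h00 => hne (by simpa [h00] using (key x₀ hx₀).1)
    have := (key Real.pi pi_mem_I).2
    rw [hpi, zero_sub, neg_eq_zero, mul_eq_zero, or_iff_right h00] at this
    have : ρ Real.pi * Real.sin (ν Real.pi) = 0 := by
      have := Complex.ofReal_eq_zero.1 this
      linarith
    exact (mul_eq_zero.1 this).resolve_left (hρ _).ne'
  · intro hs
    refine ⟨fun x => (ρ x * Real.cos (ν x) : ℝ), fun x => (-(ρ x * Real.sin (ν x)) : ℝ),
      ⟨0, zero_mem_I, by simp [hρ0, hν.1]⟩, by simp [hν.1], by simp [hs], fun x hx =>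
      ⟨(hder x hx).1.ofReal_comp, (hder x hx).2.ofReal_comp.congr_deriv ?_⟩⟩
    push_cast; ring

/-- Eigenvalues are real. -/
theorem HasNeumannSolution.im_eq_zero {α β g : ℝ → ℝ} (hα : ∀ x ∈ I, 0 < α x)
    (hg : ContinuousOn g I) {lam : ℂ} (h : HasNeumannSolution α β g lam) : lam.im = 0 := by
  obtain ⟨φ, ψ, ⟨x₀, hx₀, hne⟩, h0, hpi, h⟩ := h
  by_contra him
  obtain ⟨P, -, hP⟩ := exists_primitive hg
  have hre : ∀ {k : ℝ → ℂ} {k' : ℂ} {x : ℝ}, HasDerivWithinAt k k' I x →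
      HasDerivWithinAt (fun x => (k x).re) k'.re I x := fun hk =>
    Complex.reCLM.hasFDerivAt.comp_hasDerivWithinAt _ hk
  have himd : ∀ {k : ℝ → ℂ} {k' : ℂ} {x : ℝ}, HasDerivWithinAt k k' I x →
      HasDerivWithinAt (fun x => (k x).im) k'.im I x := fun hk =>
    Complex.imCLM.hasFDerivAt.comp_hasDerivWithinAt _ hk
  -- This is `e^P Im(ψ φ̄) / Im lam`: the factor `e^P` with `P' = g` cancels the first-order term,
  -- leaving the derivative `e^P α |φ|² ≥ 0`. The Neumann conditions make it vanish at both ends, so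
  -- it is constant and `φ = 0`.
  have hd : ∀ x ∈ I, HasDerivWithinAt
      (fun x => lam.im⁻¹ * (Real.exp (P x) * ((ψ x).im * (φ x).re - (ψ x).re * (φ x).im)))
      (Real.exp (P x) * (α x * ((φ x).re ^ 2 + (φ x).im ^ 2))) I x := fun x hx => by
    obtain ⟨h1, h2⟩ := h x hx
    have := ((hP x hx).exp.mul (((himd h2).mul (hre h1)).sub ((hre h2).mul (himd h1)))).const_mul
      lam.im⁻¹
    refine this.congr_deriv ?_
    rw [inv_mul_eq_iff_eq_mul₀ him]
    simp
    ring
  have hmono := monotoneOn_of_hasDerivWithinAt_nonneg (convex_Icc 0 Real.pi)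
    (fun x hx => (hd x hx).continuousWithinAt)
    (fun x hx => (hd x (interior_subset hx)).mono interior_subset) fun x hx => by
      have := hα x (interior_subset hx)
      positivity
  have hz : ∀ x ∈ I,
      lam.im⁻¹ * (Real.exp (P x) * ((ψ x).im * (φ x).re - (ψ x).re * (φ x).im)) = 0 :=
    fun x hx => by
      have h1 := hmono zero_mem_I hx hx.1
      have h2 := hmono hx pi_mem_I hx.2
      simp only [h0, hpi, Complex.zero_re, Complex.zero_im, zero_mul, sub_zero, mul_zero] at h1 h2
      exact le_antisymm h2 h1
  have hd0 : HasDerivWithinAt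
      (fun x => lam.im⁻¹ * (Real.exp (P x) * ((ψ x).im * (φ x).re - (ψ x).re * (φ x).im)))
      0 I x₀ := (hasDerivWithinAt_const x₀ I (0 : ℝ)).congr hz (hz x₀ hx₀)
  have := (uniqueDiffOn_I x₀ hx₀).eq_deriv I hd0 (hd x₀ hx₀)
  have hα0 := hα x₀ hx₀
  have hsq : (φ x₀).re ^ 2 + (φ x₀).im ^ 2 = 0 := by
    have h1 := (mul_eq_zero.1 this.symm).resolve_left (Real.exp_pos _).ne'
    exact (mul_eq_zero.1 h1).resolve_left hα0.ne'
  apply hne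
  apply Complex.ext <;> simp <;> nlinarith [sq_nonneg (φ x₀).re, sq_nonneg (φ x₀).im]

end Eigenvalues

/-! ### The shooting field, equilibria and their linearization. -/

section Shooting

variable {a f : ℝ → ℝ → ℝ → ℝ} {u : I → ℝ}

theorem isCoeff_one_of_two {h : ℝ → ℝ → ℝ → ℝ} (hh : IsCoeff 2 h) : IsCoeff 1 h :=
  ContDiffOn.of_le hh (by norm_num)

/-- A coefficient as a function of `x` and `(u, p)`. -/
def coeffFun (h : ℝ → ℝ → ℝ → ℝ) (q : ℝ × ℝ × ℝ) : ℝ := h q.1 q.2.1 q.2.2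

theorem IsCoeff.contDiffOn_coeffFun {h : ℝ → ℝ → ℝ → ℝ} (hh : IsCoeff 1 h) :
    ContDiffOn ℝ 1 (coeffFun h) (I ×ˢ univ) := by
  have h1 : ContDiffOn ℝ ((1 : ℕ) : WithTop ℕ∞) (coeffFun h) (I ×ˢ univ) := hh
  simpa using h1

theorem IsCoeff.partialU_eq {h : ℝ → ℝ → ℝ → ℝ} (hh : IsCoeff 1 h) {x : ℝ} (hx : x ∈ I)
    (v p : ℝ) : partialU h x v p = sliceFDeriv (coeffFun h) (x, v, p) (1, 0) := by
  have h1 := hasFDerivAt_slice hh.contDiffOn_coeffFun hx (v, p)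
  have h2 : HasDerivAt (fun s : ℝ => (s, p)) ((1 : ℝ), (0 : ℝ)) v :=
    (hasDerivAt_id v).prodMk (hasDerivAt_const v p)
  exact (h1.comp_hasDerivAt v h2).deriv

theorem IsCoeff.partialP_eq {h : ℝ → ℝ → ℝ → ℝ} (hh : IsCoeff 1 h) {x : ℝ} (hx : x ∈ I)
    (v p : ℝ) : partialP h x v p = sliceFDeriv (coeffFun h) (x, v, p) (0, 1) := by
  have h1 := hasFDerivAt_slice hh.contDiffOn_coeffFun hx (v, p)
  have h2 : HasDerivAt (fun s : ℝ => (v, s)) ((0 : ℝ), (1 : ℝ)) p :=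
    (hasDerivAt_const p v).prodMk (hasDerivAt_id p)
  exact (h1.comp_hasDerivAt p h2).deriv

theorem IsCoeff.sliceFDeriv_apply {h : ℝ → ℝ → ℝ → ℝ} (hh : IsCoeff 1 h) {x : ℝ} (hx : x ∈ I)
    (v p y z : ℝ) : sliceFDeriv (coeffFun h) (x, v, p) (y, z)
      = partialU h x v p * y + partialP h x v p * z := by
  rw [hh.partialU_eq hx, hh.partialP_eq hx]
  have : ((y, z) : ℝ × ℝ) = y • ((1 : ℝ), (0 : ℝ)) + z • ((0 : ℝ), (1 : ℝ)) := by simp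
  rw [this, map_add, map_smul, map_smul]
  simp [mul_comm]

theorem IsCoeff.continuousOn_along {h : ℝ → ℝ → ℝ → ℝ} (hh : IsCoeff 1 h) {w : ℝ → ℝ × ℝ}
    (hw : ContinuousOn w I) : ContinuousOn (fun x => h x (w x).1 (w x).2) I ∧
      ContinuousOn (fun x => partialU h x (w x).1 (w x).2) I ∧
      ContinuousOn (fun x => partialP h x (w x).1 (w x).2) I := by
  have hm : MapsTo (fun x => (x, w x)) I (I ×ˢ univ) := fun x hx => ⟨hx, mem_univ _⟩
  have hc : ContinuousOn (fun x => (x, w x)) I := continuousOn_id.prodMk hw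
  have hs := (continuousOn_sliceFDeriv hh.contDiffOn_coeffFun).comp hc hm
  refine ⟨hh.contDiffOn_coeffFun.continuousOn.comp hc hm, ?_, ?_⟩
  · exact (hs.clm_apply continuousOn_const).congr fun x hx => hh.partialU_eq hx _ _
  · exact (hs.clm_apply continuousOn_const).congr fun x hx => hh.partialP_eq hx _ _

/-- The vector field `(p, -f / a)` of the shooting problem. -/
noncomputable def shootField (a f : ℝ → ℝ → ℝ → ℝ) (q : ℝ × ℝ × ℝ) : ℝ × ℝ :=
  (q.2.2, -(coeffFun f q / coeffFun a q))

theorem contDiffOn_shootField (ha : IsCoeff 1 a) (hf : IsCoeff 2 f)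
    (hne : ∀ x ∈ I, ∀ v p, a x v p ≠ 0) :
    ContDiffOn ℝ 1 (shootField a f) (I ×ˢ univ) := by
  have h1 := ha.contDiffOn_coeffFun
  have h2 := (isCoeff_one_of_two hf).contDiffOn_coeffFun
  exact contDiff_snd.snd.contDiffOn.prodMk (h2.div h1 fun q hq => hne _ hq.1 _ _).neg

theorem sliceFDeriv_shootField (ha : IsCoeff 1 a) (hf : IsCoeff 2 f)
    (hne : ∀ x ∈ I, ∀ v p, a x v p ≠ 0) {x : ℝ} (hx : x ∈ I) (v p y z : ℝ) :
    sliceFDeriv (shootField a f) (x, v, p) (y, z) = (z,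
      -(((partialU f x v p * a x v p - f x v p * partialU a x v p) / a x v p ^ 2) * y
        + ((partialP f x v p * a x v p - f x v p * partialP a x v p) / a x v p ^ 2) * z)) := by
  have hf1 := isCoeff_one_of_two hf
  have h1 := hasFDerivAt_slice (contDiffOn_shootField ha hf hne) hx (v, p)
  have h2 := hasFDerivAt_slice ha.contDiffOn_coeffFun hx (v, p)
  have h3 := hasFDerivAt_slice hf1.contDiffOn_coeffFun hx (v, p)
  -- Both sides are the derivative at `t = 0` along this line, once by the chain rule and once by
  -- the quotient rule.
  have hl : HasDerivAt (fun t : ℝ => (v, p) + t • (y, z)) (y, z) 0 := by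
    simpa using ((hasDerivAt_id (0 : ℝ)).smul_const (y, z)).const_add (v, p)
  have e : (v, p) + (0 : ℝ) • (y, z) = (v, p) := by simp
  rw [← e] at h1 h2 h3
  have k1 := h1.comp_hasDerivAt 0 hl
  have k2 := h2.comp_hasDerivAt 0 hl
  have k3 := h3.comp_hasDerivAt 0 hl
  rw [e] at k1 k2 k3
  rw [ha.sliceFDeriv_apply hx] at k2
  rw [hf1.sliceFDeriv_apply hx] at k3
  have hne0 : coeffFun a (x, (v, p) + (0 : ℝ) • (y, z)) ≠ 0 := hne x hx _ _
  have hl2 : HasDerivAt (fun t : ℝ => ((v, p) + t • (y, z)).2) z 0 := by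
    simpa using ((hasDerivAt_id (0 : ℝ)).mul_const z).const_add p
  have k4 := hl2.prodMk (k3.div k2 hne0).neg
  refine (k1.unique k4).trans ?_
  simp only [Function.comp, e]
  ext
  · rfl
  · simp only [coeffFun]; ring

theorem onLine_apply (u : I → ℝ) (x : I) : onLine u x = u x := IccExtend_val _ _ _

theorem onLine_zero (u : I → ℝ) : onLine u 0 = u leftEnd := onLine_apply u leftEnd

theorem onLine_pi (u : I → ℝ) : onLine u Real.pi = u rightEnd := onLine_apply u rightEnd

/-- The curve `(u, u')` of a function on `[0, π]`. -/
noncomputable def phaseCurve (u : I → ℝ) (x : ℝ) : ℝ × ℝ := (onLine u x, D (onLine u) x)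

theorem IsEquilibrium.isTrajectory (hne : ∀ x ∈ I, ∀ v p, a x v p ≠ 0)
    (hu : IsEquilibrium a f u) : IsTrajectory (shootField a f) (phaseCurve u) := by
  intro x hx
  obtain ⟨h1, h2, -⟩ := hasDerivWithinAt_of_contDiffOn_two hu.1
  refine ((h1 x hx).prodMk (h2 x hx)).congr_deriv (Prod.ext rfl ?_)
  have h3 := hu.2.2.2 x hx
  have h4 := hne x hx (onLine u x) (D (onLine u) x)
  simp only [shootField, coeffFun, phaseCurve]
  field_simp
  linarith

theorem isShootingSolution_iff {b : ℝ} {w : ℝ → ℝ × ℝ} :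
    IsShootingSolution a f b w ↔ w 0 = (b, 0) ∧ IsTrajectory (shootField a f) w := Iff.rfl

theorem isTrajectory_shoot (hglobal : ∀ b : ℝ, ∃ w : ℝ → ℝ × ℝ, IsShootingSolution a f b w)
    (b : ℝ) : shoot a f b 0 = (b, 0) ∧ IsTrajectory (shootField a f) (shoot a f b) :=
  isShootingSolution_iff.1 (Classical.epsilon_spec (hglobal b))

theorem IsEquilibrium.shoot_eqOn (ha : IsCoeff 1 a) (hf : IsCoeff 2 f)
    (hne : ∀ x ∈ I, ∀ v p, a x v p ≠ 0)
    (hglobal : ∀ b : ℝ, ∃ w : ℝ → ℝ × ℝ, IsShootingSolution a f b w)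
    (hu : IsEquilibrium a f u) : EqOn (shoot a f (u leftEnd)) (phaseCurve u) I := by
  obtain ⟨h0, hs⟩ := isTrajectory_shoot hglobal (u leftEnd)
  refine hs.eqOn_of_eq_zero (contDiffOn_shootField ha hf hne) (hu.isTrajectory hne) ?_
  rw [h0, phaseCurve, onLine_zero, hu.2.1]

/-- A shooting trajectory that returns to the Neumann line at `π` is an equilibrium. -/
theorem exists_equilibrium_of_shoot (ha : IsCoeff 1 a) (hf : IsCoeff 2 f)
    (hne : ∀ x ∈ I, ∀ v p, a x v p ≠ 0) {w : ℝ → ℝ × ℝ} (hw : IsTrajectory (shootField a f) w)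
    (h0 : (w 0).2 = 0) (hpi : (w Real.pi).2 = 0) :
    ∃ u : I → ℝ, IsEquilibrium a f u ∧ EqOn (phaseCurve u) w I := by
  have hEq : EqOn (onLine fun x : I => (w x).1) (fun x => (w x).1) I := fun x hx =>
    onLine_apply (fun x : I => (w x).1) ⟨x, hx⟩
  have hc : ContinuousOn (fun x => (shootField a f (x, w x)).2) I :=
    ((contDiffOn_shootField ha hf hne).continuousOn.comp (continuousOn_id.prodMk hw.continuousOn)
      fun x hx => ⟨hx, mem_univ _⟩).snd
  have hfst : ∀ x ∈ I, HasDerivWithinAt (onLine fun x : I => (w x).1) (w x).2 I x := fun x hx =>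
    (hasFDerivAt_fst.comp_hasDerivWithinAt x (hw x hx)).congr hEq (hEq hx)
  obtain ⟨h1, h2, h3⟩ := contDiffOn_two_of_hasDerivWithinAt hfst
    (fun x hx => hasFDerivAt_snd.comp_hasDerivWithinAt x (hw x hx)) hc
  refine ⟨fun x => (w x).1, ⟨h1, (h2 zero_mem_I).trans h0, (h2 pi_mem_I).trans hpi,
    fun x hx => ?_⟩, fun x hx => Prod.ext (hEq hx) (h2 hx)⟩
  rw [h3 hx, h2 hx, hEq hx]
  simp only [shootField, coeffFun, ContinuousLinearMap.coe_snd']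
  have := hne x hx (w x).1 (w x).2
  field_simp
  ring

/-- Injectivity is uniqueness backwards from `x = π`; for surjectivity, the Neumann condition at 0
is built into the shooting data and the one at `π` is membership in the Neumann line. -/
theorem bijOn_equilibria (ha : IsCoeff 1 a) (hf : IsCoeff 2 f)
    (hne : ∀ x ∈ I, ∀ v p, a x v p ≠ 0)
    (hglobal : ∀ b : ℝ, ∃ w : ℝ → ℝ × ℝ, IsShootingSolution a f b w) :
    BijOn (fun u : I → ℝ => (Real.pi, u rightEnd, D (onLine u) Real.pi))
      (equilibria a f) (shootingCurve a f Real.pi ∩ neumannLine Real.pi) := by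
  refine ⟨fun u hu => ?_, fun u hu v hv huv => ?_, ?_⟩
  · have h1 := IsEquilibrium.shoot_eqOn ha hf hne hglobal hu pi_mem_I
    refine ⟨⟨⟨pi_mem_I, u leftEnd, ?_⟩, rfl⟩, u rightEnd, ?_⟩
    · rw [h1, phaseCurve, onLine_pi]
    · simp only [show D (onLine u) Real.pi = 0 from hu.2.2.1]
  · have h1 : phaseCurve u Real.pi = phaseCurve v Real.pi := by
      simp only [phaseCurve, onLine_pi]
      exact (Prod.ext_iff.1 huv).2
    have h2 := (IsEquilibrium.isTrajectory hne hu).eqOn_of_eq_pi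
      (contDiffOn_shootField ha hf hne) (IsEquilibrium.isTrajectory hne hv) h1
    funext x
    rw [← onLine_apply u, ← onLine_apply v]
    exact congrArg Prod.fst (h2 x.2)
  · rintro ⟨x, v, p⟩ ⟨⟨⟨-, b, hb⟩, hx⟩, c, hc⟩
    obtain ⟨h0, hs⟩ := isTrajectory_shoot hglobal b
    simp only at hx hb
    simp only [Prod.mk.injEq] at hc
    obtain ⟨-, rfl, rfl⟩ := hc
    subst hx
    obtain ⟨u, hu, hEq⟩ := exists_equilibrium_of_shoot ha hf hne hs (by rw [h0]) (by rw [← hb])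
    refine ⟨u, hu, ?_⟩
    have := hEq pi_mem_I
    rw [← hb, phaseCurve, onLine_pi] at this
    simp only [this]

theorem span_pair_eq_top_iff (y z : ℝ) :
    Submodule.span ℝ {((y, z) : ℝ × ℝ), ((1 : ℝ), (0 : ℝ))} = ⊤ ↔ z ≠ 0 := by
  rw [Submodule.eq_top_iff']
  constructor
  · rintro h rfl
    obtain ⟨s, t, hst⟩ := Submodule.mem_span_pair.1 (h (0, 1))
    simpa using congrArg Prod.snd hst
  · rintro hz ⟨s, t⟩
    refine Submodule.mem_span_pair.2 ⟨t / z, s - t / z * y, ?_⟩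
    ext <;> simp [hz]

/-- Reduction of the linearization at an equilibrium to a second order equation with continuous
coefficients. -/
theorem IsEquilibrium.exists_linear_coefficients (ha : IsCoeff 1 a) (hf : IsCoeff 2 f)
    (hpos : ∀ x ∈ I, ∀ v p, 0 < a x v p) (hu : IsEquilibrium a f u) :
    ∃ α β g : ℝ → ℝ, ContinuousOn α I ∧ ContinuousOn β I ∧ ContinuousOn g I ∧
      (∀ x ∈ I, 0 < α x) ∧
      (∀ lam : ℂ, IsEigenvalue a f u lam ↔ HasNeumannSolution α β g lam) ∧
      ∀ x ∈ I, ∀ y z : ℝ, sliceFDeriv (shootField a f) (x, phaseCurve u x) (y, z)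
        = (z, -(β x * y + g x * z)) := by
  have hne : ∀ x ∈ I, ∀ v p, a x v p ≠ 0 := fun x hx v p => (hpos x hx v p).ne'
  have hc := (hu.isTrajectory hne).continuousOn
  obtain ⟨ca, cau, cap⟩ := ha.continuousOn_along hc
  obtain ⟨-, cfu, cfp⟩ := (isCoeff_one_of_two hf).continuousOn_along hc
  have cuu := (hasDerivWithinAt_of_contDiffOn_two hu.1).2.2
  have hA : ∀ x ∈ I, linA a u x ≠ 0 := fun x hx => hne x hx _ _
  have cA : ContinuousOn (linA a u) I := ca
  have cB : ContinuousOn (linB a f u) I := (cau.mul cuu).add cfu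
  have cC : ContinuousOn (linC a f u) I := (cap.mul cuu).add cfp
  have hα : ContinuousOn (fun x => 1 / linA a u x) I := continuousOn_const.div cA hA
  have hβ : ContinuousOn (fun x => linB a f u x / linA a u x) I := cB.div cA hA
  have hg : ContinuousOn (fun x => linC a f u x / linA a u x) I := cC.div cA hA
  refine ⟨_, _, _, hα, hβ, hg, fun x hx => one_div_pos.2 (hpos x hx _ _),
    isEigenvalue_iff_hasNeumannSolution hα hβ hg hA
      (fun x hx => mul_one_div_cancel (hA x hx)) (fun x hx => mul_div_cancel₀ _ (hA x hx))
      (fun x hx => mul_div_cancel₀ _ (hA x hx)), fun x hx y z => ?_⟩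
  rw [phaseCurve, sliceFDeriv_shootField ha hf hne hx]
  -- With this substitution the quotient rule for `f / a` produces the `u''` terms of `linB` and
  -- `linC`.
  have h1 : f x (onLine u x) (D (onLine u) x) = -(linA a u x * D (D (onLine u)) x) := by
    have := hu.2.2.2 x hx
    simp only [linA]; linarith
  have h2 : a x (onLine u x) (D (onLine u) x) = linA a u x := rfl
  have h3 := hA x hx
  rw [h1, h2]
  simp only [linB, linC]
  congr 3
  · field_simp; ring
  · field_simp; ring

end Shooting

end SturmShooting

/-! ### The main theorem. -/

open SturmShooting in
theorem mainTheorem3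
    (a f : ℝ → ℝ → ℝ → ℝ) (ha : IsCoeff 1 a) (hf : IsCoeff 2 f)
    (ε : ℝ) (hε : 0 < ε) (hpar : ∀ x ∈ I, ∀ u p : ℝ, ε ≤ a x u p)
    (hglobal : ∀ b : ℝ, ∃ w : ℝ → ℝ × ℝ, IsShootingSolution a f b w) :
    -- equilibria correspond one-to-one to the intersection points
    Set.BijOn (fun u : I → ℝ => (Real.pi, u rightEnd, D (onLine u) Real.pi))
      (equilibria a f) (shootingCurve a f Real.pi ∩ neumannLine Real.pi) ∧
    ∀ u ∈ equilibria a f,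
      -- `u` is the trajectory that corresponds to `b = u(0)`
      (∀ x : I, shoot a f (u leftEnd) x = (u x, D (onLine u) x)) ∧
      (IsHyperbolic a f u ↔ IsTransverseAt a f (u leftEnd)) ∧
      -- the clockwise angle is well defined, and it determines the Morse index
      (∃! ζ : ℝ, IsClockwiseAngle a f (u leftEnd) ζ) ∧
      (IsHyperbolic a f u → ∀ ζ : ℝ, IsClockwiseAngle a f (u leftEnd) ζ →
        ∃ n : ℕ, morseIndex a f u = n ∧ (n : ℤ) = 1 + ⌊ζ / Real.pi⌋) := by
  have hpos : ∀ x ∈ I, ∀ v p, 0 < a x v p := fun x hx v p => hε.trans_le (hpar x hx v p)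
  have hne : ∀ x ∈ I, ∀ v p, a x v p ≠ 0 := fun x hx v p => (hpos x hx v p).ne'
  refine ⟨bijOn_equilibria ha hf hne hglobal, fun u hu => ?_⟩
  replace hu : IsEquilibrium a f u := hu
  have hEq := hu.shoot_eqOn ha hf hne hglobal
  obtain ⟨α, β, g, hα, hβ, hg, hα0, heig, hslice⟩ := hu.exists_linear_coefficients ha hf hpos
  have hq : ∀ l : ℝ, ContinuousOn (fun x => β x - l * α x) I := fun l =>
    hβ.sub (continuousOn_const.mul hα)
  choose ν hν using fun l : ℝ => exists_isPruferAngle (hq l) hg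
  obtain ⟨ρ, hρ0, hρ, hder⟩ := (hν 0).exists_radius (hq 0) hg
  have htan : ∀ x ∈ I, HasDerivAt (fun b => shoot a f b x)
      (ρ x * Real.cos (ν 0 x), -(ρ x * Real.sin (ν 0 x))) (u leftEnd) := by
    intro x hx
    refine IsTrajectory.hasDerivAt_initial (contDiffOn_shootField ha hf hne)
      (fun b => (isTrajectory_shoot hglobal b).2) (e := ((1 : ℝ), (0 : ℝ)))
      (V := fun x => (ρ x * Real.cos (ν 0 x), -(ρ x * Real.sin (ν 0 x)))) (fun b => ?_) ?_
      (fun y hy => ?_) hx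
    · simp [(isTrajectory_shoot hglobal _).1]
    · simp [hρ0, (hν 0).1]
    · rw [hEq hy, hslice y hy]
      refine ((hder y hy).1.prodMk (hder y hy).2).congr_deriv ?_
      simp
  have hang : IsClockwiseAngle a f (u leftEnd) (ν 0 Real.pi) :=
    ⟨ν 0, ρ, (hν 0).continuousOn, (hν 0).1, rfl, fun x hx => ⟨hρ x, htan x hx⟩⟩
  have huniq : ∀ ζ, IsClockwiseAngle a f (u leftEnd) ζ → ζ = ν 0 Real.pi := by
    rintro ζ ⟨μ, σ, hμ, hμ0, rfl, h⟩
    -- Two continuous angles of the same tangent vectors differ by multiples of `2π`, and they agree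
    -- at 0.
    refine sub_eq_zero.1 (eq_zero_of_cos_eq_one (d := fun x => μ x - ν 0 x)
      (hμ.sub (hν 0).continuousOn) (by simp [hμ0, (hν 0).1]) fun x hx => ?_)
    obtain ⟨hσ, hd⟩ := h x hx
    obtain ⟨e1, e2⟩ := Prod.mk.inj (hd.unique (htan x hx))
    exact cos_sub_eq_one_of_polar_eq hσ (hρ x) e1 (neg_inj.1 e2)
  have hreal : ∀ l : ℝ, IsEigenvalue a f u (l : ℂ) ↔ Real.sin (ν l Real.pi) = 0 := fun l =>
    (heig _).trans (hasNeumannSolution_ofReal_iff hα hβ hg (hν l))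
  have hhyp : IsHyperbolic a f u ↔ Real.sin (ν 0 Real.pi) ≠ 0 := by
    rw [Ne, ← hreal 0]
    refine ⟨fun h => h _ (by simp), fun h lam hlam hev => h ?_⟩
    have him := ((heig lam).1 hev).im_eq_zero hα0 hg
    rwa [show lam = ((0 : ℝ) : ℂ) from Complex.ext (by simpa using hlam) (by simpa using him)]
      at hev
  refine ⟨fun x => ?_, ?_, ⟨_, hang, huniq⟩, fun h ζ hζ => ?_⟩
  · rw [hEq x.2, phaseCurve, onLine_apply]
  · have hd := htan Real.pi pi_mem_I
    rw [hhyp, IsTransverseAt, hd.deriv, span_pair_eq_top_iff]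
    simp [hd.differentiableAt, (hρ Real.pi).ne']
  · rw [huniq ζ hζ]
    have hpi := Real.pi_pos
    have hint : ∀ l, Real.sin (ν l Real.pi) = 0 ↔ ∃ k : ℤ, ν l Real.pi / Real.pi = k := fun l => by
      rw [Real.sin_eq_zero_iff]
      refine exists_congr fun k => ?_
      rw [div_eq_iff hpi.ne', eq_comm]
    have hset : positiveEigenvalues a f u =
        {l : ℝ | 0 < l ∧ ∃ k : ℤ, ν l Real.pi / Real.pi = k} := by
      ext l
      exact and_congr_right fun _ => (hreal l).trans (hint l)
    -- At `l = Λ ≥ |β/α|` the coefficient `β - Λ α` is nonpositive, so the angle at `π` is too.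
    obtain ⟨Λ, hΛ⟩ := exists_bound_on_I (hβ.div hα fun x hx => (hα0 x hx).ne')
    rw [morseIndex, hset]
    refine encard_integer_values ((continuous_pruferAngle_pi hα hβ hg hν).div_const _)
      (fun l m hlm => div_lt_div_of_pos_right ((hν l).lt_of_lt (hq l) hg (hν m) fun x hx => ?_) hpi)
      (fun l => ?_) (Λ := Λ) ?_ fun k hk => (hhyp.1 h) ((hint 0).2 ⟨k, hk⟩)
    · have := mul_lt_mul_of_pos_right hlm (hα0 x hx)
      linarith
    · rw [lt_div_iff₀ hpi]
      have := (hν l).neg_half_pi_lt (hq l) hg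
      linarith
    · refine div_nonpos_of_nonpos_of_nonneg ((hν Λ).nonpos (hq Λ) hg fun x hx => ?_) hpi.le
      have := (div_le_iff₀ (hα0 x hx)).1 (le_of_abs_le (hΛ x hx))
      linarith
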